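/- Throughout, $\mathbf V$ is a finite set of nodes. Two DAGs on $\mathbf V$ are Markov equivalent if they have the same d-separation relations. The CPDAG $G$ of (the Markov equivalence class of) a DAG $D$ is the mixed graph with $A \to B$ if every DAG in the class has $A \to B$, and $A - B$ if some DAGs in the class have $A \to B$ and others have $B \to A$; we say that $G$ represents the DAGs of this class. Write $Pa_G(V)=\{W : W\to V \text{ in } G\}$ and $Sib_G(X)=\{V : X - V \text{ in } G\}$. A node $X$ is a possible ancestor of $Y$, $X\in PossAn_G(Y)$, if $X$ is an ancestor of $Y$ in at least one DAG represented by $G$. A possibly directed path from $X$ to $Y$ in $G$ is a path (sequence of distinct, consecutively adjacent nodes) from $X$ to $Y$ none of whose edges is directed backwards, towards $X$. $G$ is amenable relative to $(X,Y)$ if every possibly directed path from $X$ to $Y$ starts with a directed edge out of $X$. Relations $\mathbf A \perp\!\!\!\perp \mathbf B \mid \mathbf S$ are relations between pairwise disjoint sets of nodes (in particular, no node is separated from, or independent of, itself). **Lemma.** Let $X\neq Y$ be nodes of a CPDAG $G$ with $X\in PossAn_G(Y)$. Then $$G \text{ is amenable relative to } (X,Y) \iff \forall V\in Sib_G(X):\;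 V \perp\!\!\!\perp Y \mid Pa_G(V)\cup\{X\}.$$ This holds when $\perp\!\!\!\perp$ is read as d-separation in any DAG $D$ represented by $G$, and also when it is read as conditional independence in any joint distribution $p$ of (standard Borel valued) variables indexed by $\mathbf V$ that is Markov and faithful to such a DAG $D$, i.e. in which, for pairwise disjoint $\mathbf A,\mathbf B,\mathbf S$, $\mathbf A\perp\!\!\!\perp\mathbf B\mid\mathbf S$ holds if and only if $\mathbf A$ and $\mathbf B$ are d-separated by $\mathbf S$ in $D$. (The right-hand side refers to $G$ only through the siblings of $X$ and their parents.) -/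

import Mathlib

open MeasureTheory

universe u w

/-- A list of nodes that is a path from `x` to `y`: distinct nodes, consecutive ones related by the
adjacency relation `r`, starting with `x` and ending with `y`. -/
def IsPathFromTo {N : Type u} (r : N → N → Prop) (x y : N) (p : List N) : Prop :=
  p.Nodup ∧ p.IsChain r ∧ p.head? = some x ∧ p.getLast? = some y

/-- A directed acyclic graph on the node set `N`. -/
structure DAG (N : Type u) where
  toDigraph : Digraph N
  acyclic : ∀ v, ¬ Relation.TransGen toDigraph.Adj v v

namespace DAG

variable {N : Type u}

/-- The directed edge `a → b` is in `D`. -/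
def Edge (D : DAG N) (a b : N) : Prop := D.toDigraph.Adj a b

/-- `a` and `b` are connected by an edge of `D`. -/
def Adjacent (D : DAG N) (a b : N) : Prop := D.Edge a b ∨ D.Edge b a

/-- `a` is an ancestor of `b` (and `b` a descendant of `a`); every node is its own ancestor. -/
def IsAncestor (D : DAG N) (a b : N) : Prop := Relation.ReflTransGen D.Edge a b

/-- The path `p` is blocked by `S` in `D`: it has an inner node `b`, with neighbours `a` and `c` on
the path, that either is a non-collider in `S`, or is a collider without descendants in `S`
(itself included). -/
def Blocked (D : DAG N) (p : List N) (S : Set N) : Prop :=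
  ∃ a b c : N, [a, b, c] <:+: p ∧
    ((¬ (D.Edge a b ∧ D.Edge c b) ∧ b ∈ S) ∨
     ((D.Edge a b ∧ D.Edge c b) ∧ ∀ d, D.IsAncestor b d → d ∉ S))

/-- d-separation of the pairwise disjoint sets of nodes `A` and `B` by `S` in `D`. -/
def DSep (D : DAG N) (A B S : Set N) : Prop :=
  Disjoint A B ∧ Disjoint A S ∧ Disjoint B S ∧
    ∀ a ∈ A, ∀ b ∈ B, ∀ p : List N, IsPathFromTo D.Adjacent a b p → D.Blocked p S

/-- Two DAGs are Markov equivalent if they imply the same conditional independences,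
i.e. have the same d-separation relations. -/
def MarkovEquivalent (D D' : DAG N) : Prop :=
  ∀ A B S : Set N, D.DSep A B S ↔ D'.DSep A B S

end DAG

/-- A mixed graph on the node set `N`, with directed edges `a → b` and undirected edges `a - b`;
no loops and at most one edge between two nodes. -/
structure MixedGraph (N : Type u) where
  Dir : N → N → Prop
  Undir : N → N → Prop
  dir_asymm : ∀ a b, Dir a b → ¬ Dir b a
  undir_symm : ∀ a b, Undir a b → Undir b a
  undir_irrefl : ∀ a, ¬ Undir a a
  not_both : ∀ a b, Dir a b → ¬ Undir a b

namespace MixedGraph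

variable {N : Type u}

/-- `a` and `b` are connected by an edge of `G`, directed or undirected. -/
def Adjacent (G : MixedGraph N) (a b : N) : Prop := G.Dir a b ∨ G.Dir b a ∨ G.Undir a b

/-- The parents of `x`. -/
def pa (G : MixedGraph N) (x : N) : Set N := {v | G.Dir v x}

/-- The siblings of `x`. -/
def sib (G : MixedGraph N) (x : N) : Set N := {v | G.Undir x v}

/-- `G` is the CPDAG of the Markov equivalence class of `D`: `a → b` is in `G` if all DAGs in the
class have `a → b`, and `a - b` is in `G` if some have `a → b` and others have `b → a`. -/
def IsCPDAGOf (G : MixedGraph N) (D : DAG N) : Prop :=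
  (∀ a b, G.Dir a b ↔ ∀ D' : DAG N, D.MarkovEquivalent D' → D'.Edge a b) ∧
  (∀ a b, G.Undir a b ↔
    (∃ D' : DAG N, D.MarkovEquivalent D' ∧ D'.Edge a b) ∧
    (∃ D' : DAG N, D.MarkovEquivalent D' ∧ D'.Edge b a))

/-- `G` is the CPDAG of some DAG. -/
def IsCPDAG (G : MixedGraph N) : Prop := ∃ D : DAG N, G.IsCPDAGOf D

/-- The possible ancestors of `y`: the nodes that are ancestors of `y` in at least one DAG of the
Markov equivalence class represented by `G`. -/
def possAn (G : MixedGraph N) (y : N) : Set N :=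
  {x | ∃ D : DAG N, G.IsCPDAGOf D ∧ D.IsAncestor x y}

/-- `p` is a possibly directed path from `x` to `y`: a path without an edge directed
backwards. -/
def IsPossiblyDirectedPath (G : MixedGraph N) (x y : N) (p : List N) : Prop :=
  IsPathFromTo G.Adjacent x y p ∧ ∀ a b, [a, b] <:+: p → ¬ G.Dir b a

/-- `G` is amenable relative to `(x, y)`: every possibly directed path from `x` to `y` starts with
a directed edge out of `x`. -/
def Amenable (G : MixedGraph N) (x y : N) : Prop :=
  ∀ p : List N, G.IsPossiblyDirectedPath x y p → ∃ b, [x, b] <+: p ∧ G.Dir x b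

end MixedGraph

section Distributions

variable {N : Type u} {E : N → Type w} [∀ v, MeasurableSpace (E v)]

/-- The σ-algebra generated by the variables in `A`. -/
abbrev sigmaVars (E : N → Type w) [∀ v, MeasurableSpace (E v)] (A : Set N) :
    MeasurableSpace (∀ v, E v) :=
  ⨆ a ∈ A, MeasurableSpace.comap (fun z : ∀ v, E v => z a) inferInstance

theorem sigmaVars_le (A : Set N) : sigmaVars E A ≤ MeasurableSpace.pi :=
  iSup₂_le fun a _ => (measurable_pi_apply a).comap_le

/-- Conditional independence `A ⫫ B | S` in the joint distribution `p` of the variables `N`,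
for pairwise disjoint sets of variables. -/
def CondIndepVars [Finite N] [∀ v, StandardBorelSpace (E v)]
    (p : Measure (∀ v, E v)) [IsFiniteMeasure p] (A B S : Set N) : Prop :=
  Disjoint A B ∧ Disjoint A S ∧ Disjoint B S ∧
    ProbabilityTheory.CondIndep (sigmaVars E S) (sigmaVars E A) (sigmaVars E B)
      (sigmaVars_le S) p

/-- `p` is (globally) Markov to `D`. -/
def IsMarkovTo [Finite N] [∀ v, StandardBorelSpace (E v)]
    (p : Measure (∀ v, E v)) [IsFiniteMeasure p] (D : DAG N) : Prop :=
  ∀ A B S : Set N, D.DSep A B S → CondIndepVars p A B S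

/-- `p` is faithful to `D`. -/
def IsFaithfulTo [Finite N] [∀ v, StandardBorelSpace (E v)]
    (p : Measure (∀ v, E v)) [IsFiniteMeasure p] (D : DAG N) : Prop :=
  ∀ A B S : Set N, CondIndepVars p A B S → D.DSep A B S

end Distributions

/-! In a CPDAG, `a → b - c` implies `a → c` (`dir_trans_undir`). So all nodes of the undirected
component of `X` have the same parents, and no partially directed cycle exists. By `amenable_iff`,
amenability fails exactly if some sibling of `X` has a possibly directed walk to `Y` avoiding `X`.
Given such a walk from `V`, undirected edges after a directed one can be absorbed, so the walk stays
in the component for a while and then descends. The undirected part carries an active connection,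
because colliders on it are shielded and can be bypassed, and none of it meets `Pa(V) ∪ {X}`
(`active_of_reflTransGen`). Conversely, an active connection from `V` either stays in the component,
or descends for good from a node other than `X`, or ends in a common parent. The last case is
excluded for `Y` because `X` is a possible ancestor of `Y`; in the others some sibling, perhaps not
`V`, has a possibly directed walk to `Y` avoiding `X` (`exists_sib_of_active`). The chain graph
property holds for Meek's closure of the unshielded colliders (`Meek.trans_free`). That this closure
is the directed part of the CPDAG (`dir_iff`) rests on the Verma–Pearl criterion, proved through
reversals of covered edges, and on perfect orderings of the unforced edges. For a Markov and
faithful distribution, independence and d-separation coincide. -/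

namespace DAG

variable {N : Type u}

/-! ### d-separation as reachability by the Bayes ball -/

theorem Edge.asymm {D : DAG N} {a b : N} (h : D.Edge a b) : ¬ D.Edge b a := fun h' =>
  D.acyclic a (.tail (.single h) h')

theorem Edge.ne {D : DAG N} {a b : N} (h : D.Edge a b) : a ≠ b := by
  rintro rfl; exact h.asymm h

theorem Edge.not_isAncestor {D : DAG N} {a b : N} (h : D.Edge a b) : ¬ D.IsAncestor b a := fun h' =>
  D.acyclic a (Relation.TransGen.head' h h')

theorem Adjacent.symm {D : DAG N} {a b : N} (h : D.Adjacent a b) : D.Adjacent b a := Or.symm h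

theorem Adjacent.ne {D : DAG N} {a b : N} (h : D.Adjacent a b) : a ≠ b :=
  h.elim Edge.ne fun h => h.ne.symm

/-- One move of the Bayes ball: a state is a node with a mark telling whether the last edge
traversed has an arrowhead at that node. -/
def Step (D : DAG N) (S : Set N) (s t : N × Bool) : Prop :=
  (t.2 = true ∧ D.Edge s.1 t.1 ∧ s.1 ∉ S) ∨
    (t.2 = false ∧ D.Edge t.1 s.1 ∧ (s.2 = true ↔ s.1 ∈ S))

/-- The Bayes ball started at `a` reaches the state `t`. -/
abbrev Reach (D : DAG N) (S : Set N) (a : N) (t : N × Bool) : Prop :=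
  Relation.ReflTransGen (D.Step S) (a, false) t

/-- The Bayes ball started at `a` reaches `b`. -/
def Active (D : DAG N) (S : Set N) (a b : N) : Prop := ∃ m, D.Reach S a (b, m)

theorem Step.down {D : DAG N} {S : Set N} {v w : N} (m : Bool) (h : D.Edge v w) (hv : v ∉ S) :
    D.Step S (v, m) (w, true) := Or.inl ⟨rfl, h, hv⟩

theorem Step.up {D : DAG N} {S : Set N} {v w : N} (h : D.Edge w v) (hv : v ∉ S) :
    D.Step S (v, false) (w, false) := Or.inr ⟨rfl, h, by simpa using hv⟩

theorem Step.collide {D : DAG N} {S : Set N} {v w : N} (h : D.Edge w v) (hv : v ∈ S) :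
    D.Step S (v, true) (w, false) := Or.inr ⟨rfl, h, by simpa using hv⟩

theorem step_cases {D : DAG N} {S : Set N} {v w : N} {m m' : Bool} (h : D.Step S (v, m) (w, m')) :
    (m' = true ∧ D.Edge v w ∧ v ∉ S) ∨ (m' = false ∧ D.Edge w v ∧ m = false ∧ v ∉ S) ∨
      (m' = false ∧ D.Edge w v ∧ m = true ∧ v ∈ S) := by
  rcases h with h | ⟨h1, h2, h3⟩
  · exact Or.inl h
  · cases m
    · exact Or.inr (Or.inl ⟨h1, h2, rfl, by simpa using h3⟩)
    · exact Or.inr (Or.inr ⟨h1, h2, rfl, by simpa using h3⟩)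

/-- At a node outside `S` with a descendant in `S` the ball can turn around. -/
theorem reach_turn {D : DAG N} {S : Set N} {v s : N} (h : D.IsAncestor v s) (hs : s ∈ S) :
    v ∈ S ∨ Relation.ReflTransGen (D.Step S) (v, true) (v, false) := by
  induction h using Relation.ReflTransGen.head_induction_on with
  | refl => exact Or.inl hs
  | @head v v' hvv' _ ih =>
    by_cases hv : v ∈ S
    · exact Or.inl hv
    right
    rcases ih with ih | ih
    · exact (Relation.ReflTransGen.single (Step.down true hvv' hv)).tail (Step.collide hvv' ih)
    · by_cases hv' : v' ∈ S
      · exact (Relation.ReflTransGen.single (Step.down true hvv' hv)).tail (Step.collide hvv' hv')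
      · exact (ih.head (Step.down true hvv' hv)).tail (Step.up hvv' hv')

theorem not_blocked_iff {D : DAG N} {p : List N} {S : Set N} :
    ¬ D.Blocked p S ↔ ∀ a b c : N, [a, b, c] <:+: p →
      (¬ (D.Edge a b ∧ D.Edge c b) → b ∉ S) ∧
      (D.Edge a b → D.Edge c b → ∃ d, D.IsAncestor b d ∧ d ∈ S) := by
  unfold Blocked
  push Not
  refine forall_congr' fun a => forall_congr' fun b => forall_congr' fun c =>
    forall_congr' fun h => and_congr (Iff.rfl.trans (by tauto)) (by tauto)

/-- The ball follows the path. At a collider outside `S` it makes a detour down to a descendant in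
`S` and back, by `reach_turn`. -/
theorem exists_reach_of_isChain {D : DAG N} {S : Set N} {a y : N} (l : List N) (x v : N) (m : Bool)
    (hc : (x :: v :: l).IsChain D.Adjacent) (hb : ¬ D.Blocked (x :: v :: l) S)
    (hl : (x :: v :: l).getLast? = some y) (hm : m = true ↔ D.Edge x v) (hr : D.Reach S a (v, m)) :
    D.Active S a y := by
  induction l generalizing x v m with
  | nil =>
    simp only [List.getLast?_cons_cons, List.getLast?_singleton, Option.some.injEq] at hl
    exact ⟨m, hl ▸ hr⟩
  | cons w l ih =>
    rw [List.isChain_cons_cons] at hc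
    have hvw := (List.isChain_cons_cons.1 hc.2).1
    have hb' : ¬ D.Blocked (v :: w :: l) S := by
      rw [not_blocked_iff] at hb ⊢
      exact fun a b c h => hb a b c (h.trans (List.suffix_cons _ _).isInfix)
    obtain ⟨h1, h2⟩ := not_blocked_iff.1 hb x v w ⟨[], l, by simp⟩
    rw [List.getLast?_cons_cons] at hl
    by_cases hvw' : D.Edge v w
    · exact ih v w true hc.2 hb' hl (by simpa using hvw')
        (hr.tail (Step.down m hvw' (h1 fun h => hvw'.asymm h.2)))
    · have hwv : D.Edge w v := hvw.resolve_left hvw'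
      refine ih v w false hc.2 hb' hl (by simpa using hvw') ?_
      by_cases hxv : D.Edge x v
      · obtain rfl := hm.2 hxv
        obtain ⟨d, hd, hdS⟩ := h2 hxv hwv
        by_cases hvS : v ∈ S
        · exact hr.tail (Step.collide hwv hvS)
        · exact (hr.trans ((reach_turn hd hdS).resolve_left hvS)).tail (Step.up hwv hvS)
      · have : m = false := by simpa [hxv] using hm
        subst this
        exact hr.tail (Step.up hwv (h1 fun h => hxv h.1))

/-- An unblocked path that starts downwards keeps descending until its first collider, which has a
descendant in `S`. -/
theorem isAncestor_or_of_not_blocked {D : DAG N} {S : Set N} {z : N} (l : List N) (x y : N)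
    (hc : (x :: y :: l).IsChain D.Adjacent) (hxy : D.Edge x y)
    (hb : ¬ D.Blocked (x :: y :: l) S) (hz : z ∈ y :: l) :
    D.IsAncestor y z ∨ ∃ s ∈ S, D.IsAncestor y s := by
  induction l generalizing x y with
  | nil =>
    obtain rfl : z = y := by simpa using hz
    exact Or.inl .refl
  | cons w l ih =>
    rw [List.isChain_cons_cons] at hc
    have hyw := (List.isChain_cons_cons.1 hc.2).1
    have hb' : ¬ D.Blocked (y :: w :: l) S := by
      rw [not_blocked_iff] at hb ⊢
      exact fun a b c h => hb a b c (h.trans (List.suffix_cons _ _).isInfix)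
    rcases List.mem_cons.1 hz with rfl | hz
    · exact Or.inl .refl
    rcases hyw with hyw | hwy
    · rcases ih y w hc.2 hyw hb' hz with h | ⟨s, hs, h⟩
      · exact Or.inl (h.head hyw)
      · exact Or.inr ⟨s, hs, h.head hyw⟩
    · obtain ⟨d, hd, hdS⟩ := (not_blocked_iff.1 hb x y w ⟨[], l, by simp⟩).2 hxy hwy
      exact Or.inr ⟨d, hdS, hd⟩

/-- The ball's walk may repeat nodes; the path is built from its end, cutting a loop whenever the
new node already occurs. The last clause records that the first edge of the path is a legal
continuation of the mark at the start. A collider there needs only a descendant in `S`, which is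
what survives the cutting. -/
theorem exists_path_of_reach {D : DAG N} {S : Set N} {y : N} {m' : Bool} {s : N × Bool}
    (h : Relation.ReflTransGen (D.Step S) s (y, m')) :
    ∃ l : List N, (s.1 :: l).Nodup ∧ (s.1 :: l).IsChain D.Adjacent ∧
      (s.1 :: l).getLast? = some y ∧ ¬ D.Blocked (s.1 :: l) S ∧
      ∀ w, l.head? = some w → (D.Edge s.1 w → s.1 ∉ S) ∧
        (D.Edge w s.1 → (s.2 = true → ∃ d ∈ S, D.IsAncestor s.1 d) ∧ (s.2 = false → s.1 ∉ S)) := by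
  induction h using Relation.ReflTransGen.head_induction_on with
  | refl =>
    refine ⟨[], by simp, by simp, by simp, ?_, by simp⟩
    rw [not_blocked_iff]
    intro a b c h
    simpa using h.length_le
  | @head s t hst _ ih =>
    obtain ⟨x, m⟩ := s
    obtain ⟨v, n⟩ := t
    obtain ⟨l, hnd, hc, hl, hb, he⟩ := ih
    dsimp only at *
    have hst' := step_cases hst
    have hadj : D.Adjacent x v := by unfold Adjacent; tauto
    have hc' : (x :: v :: l).IsChain D.Adjacent := List.isChain_cons_cons.2 ⟨hadj, hc⟩
    have hb' : ¬ D.Blocked (x :: v :: l) S := by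
      rw [not_blocked_iff]
      intro a b c h
      rcases List.infix_cons_iff.1 h with h | h
      · obtain ⟨t, ht⟩ := h
        simp only [List.cons_append, List.nil_append, List.cons.injEq] at ht
        obtain ⟨rfl, rfl, rfl⟩ := ht
        obtain ⟨h1, h2⟩ := he c rfl
        have hbc : D.Adjacent b c := (List.isChain_cons_cons.1 hc).1
        have hn : n = true ↔ D.Edge a b := by
          rcases hst' with ⟨rfl, h, _⟩ | ⟨rfl, h, _⟩ | ⟨rfl, h, _⟩
          · simpa using h
          · simpa using h.asymm
          · simpa using h.asymm
        constructor
        · intro hnc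
          by_cases hbc' : D.Edge b c
          · exact h1 hbc'
          · have hcb := hbc.resolve_left hbc'
            refine (h2 hcb).2 ?_
            by_contra hcon
            exact hnc ⟨hn.1 (by simpa using hcon), hcb⟩
        · intro hab hcb
          obtain ⟨d, hd, hd'⟩ := (h2 hcb).1 (hn.2 hab)
          exact ⟨d, hd', hd⟩
      · exact not_blocked_iff.1 hb a b c h
    by_cases hx : x ∈ v :: l
    · obtain ⟨q, t, hqt⟩ := List.append_of_mem hx
      have hsuf : (x :: t) <:+ (v :: l) := ⟨q, hqt.symm⟩
      refine ⟨t, hnd.sublist hsuf.sublist, hc.suffix hsuf, ?_, ?_, ?_⟩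
      · rw [← hl, hqt]; simp [List.getLast?_append, List.getLast?_cons]
      · rw [not_blocked_iff] at hb ⊢
        exact fun a b c h => hb a b c (h.trans hsuf.isInfix)
      · intro w hw
        obtain ⟨t', rfl⟩ : ∃ t', t = w :: t' := by
          cases t with
          | nil => simp at hw
          | cons a t' => exact ⟨t', by simpa using hw⟩
        obtain ⟨q', z, rfl⟩ : ∃ q' z, q = q' ++ [z] := by
          rcases List.eq_nil_or_concat q with rfl | ⟨q', z, rfl⟩
          · simp only [List.nil_append, List.cons.injEq] at hqt
            exact absurd hqt.1.symm hadj.ne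
          · exact ⟨q', z, by simp⟩
        obtain ⟨h1, h2⟩ := not_blocked_iff.1 hb z x w ⟨q', t', by rw [hqt]; simp⟩
        refine ⟨fun h => h1 fun h' => h.asymm h'.2, fun hwx => ⟨?_, ?_⟩⟩
        · rintro rfl
          rcases hst' with ⟨rfl, h, hxS⟩ | ⟨rfl, h, h', _⟩ | ⟨rfl, h, _, hxS⟩
          -- The removed loop left `x` downwards. It cannot lead back to `x` by descent alone, so it
          -- turned at a collider, which supplies a descendant of `x` in `S`.
          · rcases isAncestor_or_of_not_blocked l x v hc' h hb' hx with h' | ⟨d, hd, h'⟩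
            · exact absurd h' h.not_isAncestor
            · exact ⟨d, hd, h'.head h⟩
          · cases h'
          · exact ⟨x, hxS, .refl⟩
        · rintro rfl
          rcases hst' with ⟨rfl, h, hxS⟩ | ⟨rfl, h, h', hxS⟩ | ⟨rfl, h, h', hxS⟩
          · exact hxS
          · exact hxS
          · cases h'
    · refine ⟨v :: l, List.nodup_cons.2 ⟨hx, hnd⟩, hc', by rw [List.getLast?_cons_cons, hl], hb', ?_⟩
      intro w hw
      obtain rfl : v = w := by simpa using hw
      rcases hst' with ⟨rfl, h, hxS⟩ | ⟨rfl, h, rfl, hxS⟩ | ⟨rfl, h, rfl, hxS⟩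
      · exact ⟨fun _ => hxS, fun h' => absurd h' h.asymm⟩
      · exact ⟨fun _ => hxS, fun h' => ⟨by simp, fun _ => hxS⟩⟩
      · exact ⟨fun h' => absurd h' h.asymm, fun h' => ⟨fun _ => ⟨x, hxS, .refl⟩, by simp⟩⟩

/-- The initial mark `false` lets the ball leave `a ∉ S` in every direction. -/
theorem active_iff_exists_path {D : DAG N} {S : Set N} {a b : N} (hab : a ≠ b) (ha : a ∉ S) :
    D.Active S a b ↔ ∃ p, IsPathFromTo D.Adjacent a b p ∧ ¬ D.Blocked p S := by
  constructor
  · rintro ⟨m, h⟩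
    obtain ⟨l, hnd, hc, hl, hb, -⟩ := exists_path_of_reach h
    exact ⟨a :: l, ⟨hnd, hc, rfl, hl⟩, hb⟩
  · rintro ⟨p, ⟨-, hc, hh, hl⟩, hb⟩
    match p, hc, hh, hl, hb with
    | [], _, hh, _, _ => simp at hh
    | [x], _, hh, hl, _ =>
      simp at hh hl
      exact absurd (hh.symm.trans hl) hab
    | x :: v :: l, hc, hh, hl, hb =>
      obtain rfl : x = a := by simpa using hh
      by_cases h : D.Edge x v
      · exact exists_reach_of_isChain l x v true hc hb hl (by simpa using h)
          (.single (Step.down _ h ha))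
      · exact exists_reach_of_isChain l x v false hc hb hl (by simpa using h)
          (.single (Step.up ((List.isChain_cons_cons.1 hc).1.resolve_left h) ha))

theorem dSep_iff {D : DAG N} {A B S : Set N} :
    D.DSep A B S ↔ Disjoint A B ∧ Disjoint A S ∧ Disjoint B S ∧
      ∀ a ∈ A, ∀ b ∈ B, ¬ D.Active S a b := by
  unfold DSep
  refine and_congr_right fun hAB => and_congr_right fun hAS => and_congr_right fun _ => ?_
  refine forall₂_congr fun a ha => forall₂_congr fun b hb => ?_
  rw [active_iff_exists_path (hAB.ne_of_mem ha hb) (hAS.notMem_of_mem_left ha)]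
  push Not
  rfl

theorem dSep_singleton_iff {D : DAG N} {a b : N} {S : Set N} :
    D.DSep {a} {b} S ↔ a ≠ b ∧ a ∉ S ∧ b ∉ S ∧ ¬ D.Active S a b := by
  simp [dSep_iff]

end DAG

/-! ### Markov equivalence as equality of adjacencies and unshielded colliders -/

namespace DAG

variable {N : Type u}

/-- `D` and `D'` have the same adjacencies and the same unshielded colliders. -/
structure SameVStruct (D D' : DAG N) : Prop where
  adj : ∀ a b, D.Adjacent a b ↔ D'.Adjacent a b
  collider : ∀ a b c, a ≠ c → ¬ D.Adjacent a c →
    (D.Edge a b ∧ D.Edge c b ↔ D'.Edge a b ∧ D'.Edge c b)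

theorem MarkovEquivalent.refl (D : DAG N) : D.MarkovEquivalent D := fun _ _ _ => Iff.rfl

theorem MarkovEquivalent.symm {D D' : DAG N} (h : D.MarkovEquivalent D') :
    D'.MarkovEquivalent D := fun A B S => (h A B S).symm

theorem MarkovEquivalent.trans {D D' D'' : DAG N} (h : D.MarkovEquivalent D')
    (h' : D'.MarkovEquivalent D'') : D.MarkovEquivalent D'' :=
  fun A B S => (h A B S).trans (h' A B S)

theorem SameVStruct.trans {D D' D'' : DAG N} (h : D.SameVStruct D')
    (h' : D'.SameVStruct D'') : D.SameVStruct D'' where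
  adj a b := (h.adj a b).trans (h'.adj a b)
  collider a b c hac hn := (h.collider a b c hac hn).trans
    (h'.collider a b c hac fun hh => hn ((h.adj a c).2 hh))

theorem Adjacent.not_dSep {D : DAG N} {a b : N} (h : D.Adjacent a b) (S : Set N) :
    ¬ D.DSep {a} {b} S := by
  rw [dSep_singleton_iff]
  rintro ⟨-, ha, -, hn⟩
  rcases h with h | h
  · exact hn ⟨true, .single (Step.down _ h ha)⟩
  · exact hn ⟨false, .single (Step.up h ha)⟩

/-- A node is separated by its parents from its other nondescendants. -/
theorem dSep_parents {D : DAG N} {a b : N} (hab : a ≠ b) (h : ¬ D.Adjacent a b)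
    (hanc : ¬ D.IsAncestor b a) : D.DSep {b} {a} {p | D.Edge p b} := by
  rw [dSep_singleton_iff]
  refine ⟨hab.symm, fun h => h.ne rfl, fun h' => h (Or.inl h'), ?_⟩
  rintro ⟨m, hr⟩
  -- The ball is at its start, or stuck at a parent of `b` entered from below, or among the
  -- descendants of `b`, where no parent of `b` can make it turn.
  have key : ∀ t : N × Bool, D.Reach {p | D.Edge p b} b t →
      t = (b, false) ∨ (t.2 = false ∧ D.Edge t.1 b) ∨ (t.2 = true ∧ D.IsAncestor b t.1) := by
    intro t ht
    induction ht with
    | refl => exact Or.inl rfl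
    | @tail s t _ hst ih =>
      obtain ⟨v, m⟩ := s
      obtain ⟨w, m'⟩ := t
      simp only [Prod.mk.injEq] at ih ⊢
      rcases step_cases hst with ⟨rfl, hvw, hv⟩ | ⟨rfl, hwv, rfl, hv⟩ | ⟨rfl, hwv, rfl, hv⟩
      · rcases ih with ⟨rfl, rfl⟩ | ⟨rfl, h⟩ | ⟨rfl, h⟩
        · exact Or.inr (Or.inr ⟨rfl, .single hvw⟩)
        · exact absurd h hv
        · exact Or.inr (Or.inr ⟨rfl, h.tail hvw⟩)
      · rcases ih with ⟨rfl, _⟩ | ⟨_, h⟩ | ⟨h, _⟩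
        · exact Or.inr (Or.inl ⟨rfl, hwv⟩)
        · exact absurd h hv
        · cases h
      · rcases ih with ⟨_, h'⟩ | ⟨h', _⟩ | ⟨_, h⟩
        · cases h'
        · cases h'
        · exact absurd h (Edge.not_isAncestor hv)
  rcases key _ hr with h' | ⟨_, h'⟩ | ⟨_, h'⟩
  · exact hab (by simpa using congrArg Prod.fst h')
  · exact h (Or.inl h')
  · exact hanc h'

/-- One of the two nodes is not an ancestor of the other, and its parents separate them. The
disjunction accounts for the order of the arguments. -/
theorem exists_dSep {D : DAG N} {a b : N} (hab : a ≠ b) (h : ¬ D.Adjacent a b) :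
    ∃ S, D.DSep {a} {b} S ∨ D.DSep {b} {a} S := by
  by_cases hanc : D.IsAncestor b a
  · refine ⟨_, Or.inl (dSep_parents hab.symm (fun h' => h h'.symm) fun h' => ?_)⟩
    rcases Relation.reflTransGen_iff_eq_or_transGen.1 hanc with rfl | hanc
    · exact hab rfl
    · exact D.acyclic b (hanc.trans_left h')
  · exact ⟨_, Or.inr (dSep_parents hab h hanc)⟩

theorem MarkovEquivalent.adjacent {D D' : DAG N} (h : D.MarkovEquivalent D') {a b : N}
    (hab : D.Adjacent a b) : D'.Adjacent a b := by
  by_contra hn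
  obtain ⟨S, hS | hS⟩ := exists_dSep hab.ne hn
  · exact hab.not_dSep S ((h _ _ _).2 hS)
  · exact hab.symm.not_dSep S ((h _ _ _).2 hS)

theorem not_dSep_of_collider {D : DAG N} {a b c : N} {S : Set N} (hab : D.Edge a b)
    (hcb : D.Edge c b) (hb : b ∈ S) : ¬ D.DSep {a} {c} S := by
  rw [dSep_singleton_iff]
  rintro ⟨-, ha, -, hn⟩
  exact hn ⟨false, (Relation.ReflTransGen.single (Step.down _ hab ha)).tail (Step.collide hcb hb)⟩

theorem DSep.mem_of_not_collider {D : DAG N} {a b c : N} {S : Set N} (h : D.DSep {a} {c} S)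
    (hab : D.Adjacent a b) (hbc : D.Adjacent b c) (hn : ¬ (D.Edge a b ∧ D.Edge c b)) : b ∈ S := by
  rw [dSep_singleton_iff] at h
  obtain ⟨-, ha, -, hna⟩ := h
  by_contra hb
  refine hna ?_
  rcases hab with hab | hba
  · exact ⟨true, (Relation.ReflTransGen.single (Step.down _ hab ha)).tail
      (Step.down _ (hbc.resolve_right fun h => hn ⟨hab, h⟩) hb)⟩
  · rcases hbc with hbc | hcb
    · exact ⟨true, (Relation.ReflTransGen.single (Step.up hba ha)).tail (Step.down _ hbc hb)⟩
    · exact ⟨false, (Relation.ReflTransGen.single (Step.up hba ha)).tail (Step.up hcb hb)⟩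

/-- A separator of `a` and `c` must contain `b` if `b` is a noncollider between them, and must not
if `b` is a collider. -/
theorem MarkovEquivalent.collider {D D' : DAG N} (h : D.MarkovEquivalent D') {a b c : N}
    (hac : a ≠ c) (hn : ¬ D.Adjacent a c) (hab : D.Edge a b) (hcb : D.Edge c b) :
    D'.Edge a b ∧ D'.Edge c b := by
  by_contra hcol
  have hab' := h.adjacent (Or.inl hab)
  have hcb' := h.adjacent (Or.inl hcb)
  obtain ⟨S, hS | hS⟩ := exists_dSep hac fun h' => hn (h.symm.adjacent h')
  · exact not_dSep_of_collider hab hcb (hS.mem_of_not_collider hab' hcb'.symm hcol)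
      ((h _ _ _).2 hS)
  · exact not_dSep_of_collider hcb hab (hS.mem_of_not_collider hcb' hab'.symm
      fun h => hcol h.symm) ((h _ _ _).2 hS)

theorem MarkovEquivalent.sameVStruct {D D' : DAG N} (h : D.MarkovEquivalent D') :
    D.SameVStruct D' where
  adj _ _ := ⟨h.adjacent, h.symm.adjacent⟩
  collider _ _ _ hac hn := ⟨fun h' => h.collider hac hn h'.1 h'.2,
    fun h' => h.symm.collider hac (fun hh => hn (h.symm.adjacent hh)) h'.1 h'.2⟩

/-- The edge `x → y` is covered: the parents of `y` are `x` and the parents of `x`. -/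
structure Covered (D : DAG N) (x y : N) : Prop where
  edge : D.Edge x y
  parents : ∀ p, p ≠ x → (D.Edge p y ↔ D.Edge p x)

/-- The edges of `D` after reversal of the edge `x → y`. -/
def FlipEdge (D : DAG N) (x y a b : N) : Prop :=
  (D.Edge a b ∧ ¬ (a = x ∧ b = y)) ∨ (a = y ∧ b = x)

/-- This gives acyclicity after the reversal: another directed path from `x` to `y` would end in a
parent of `y`, hence of `x`, closing a cycle in `D`. -/
theorem Covered.reach_flipEdge {D : DAG N} {x y : N} (h : D.Covered x y) {v : N}
    (hv : Relation.ReflTransGen (D.FlipEdge x y) x v) : v ≠ y ∧ D.IsAncestor x v := by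
  induction hv with
  | refl => exact ⟨h.edge.ne, .refl⟩
  | @tail v w _ hvw ih =>
    rcases hvw with ⟨hvw, hne⟩ | ⟨rfl, -⟩
    · refine ⟨?_, ih.2.tail hvw⟩
      rintro rfl
      have hvx : v ≠ x := fun hh => hne ⟨hh, rfl⟩
      exact ((h.parents v hvx).1 hvw).not_isAncestor ih.2
    · exact absurd rfl ih.1

/-- The DAG obtained by reversal of a covered edge. -/
def flip (D : DAG N) {x y : N} (h : D.Covered x y) : DAG N where
  toDigraph := ⟨D.FlipEdge x y⟩
  acyclic := by
    have key : ∀ v w, Relation.TransGen (D.FlipEdge x y) v w → Relation.TransGen D.Edge v w ∨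
        (Relation.ReflTransGen (D.FlipEdge x y) v y ∧
          Relation.ReflTransGen (D.FlipEdge x y) x w) := by
      intro v w hvw
      induction hvw with
      | single hvw =>
        rcases hvw with ⟨hvw, -⟩ | ⟨rfl, rfl⟩
        · exact Or.inl (.single hvw)
        · exact Or.inr ⟨.refl, .refl⟩
      | @tail w u hvw hwu ih =>
        rcases ih with ih | ih
        · rcases hwu with ⟨hwu, -⟩ | ⟨rfl, rfl⟩
          · exact Or.inl (ih.tail hwu)
          · exact Or.inr ⟨hvw.to_reflTransGen, .refl⟩
        · exact Or.inr ⟨ih.1, ih.2.tail hwu⟩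
    intro v hv
    rcases key v v hv with hv | ⟨h1, h2⟩
    · exact D.acyclic v hv
    · exact (h.reach_flipEdge (h2.trans h1)).1 rfl

theorem flip_edge {D : DAG N} {x y : N} (h : D.Covered x y) {a b : N} :
    (D.flip h).Edge a b ↔ (D.Edge a b ∧ ¬ (a = x ∧ b = y)) ∨ (a = y ∧ b = x) := Iff.rfl

theorem Covered.flip {D : DAG N} {x y : N} (h : D.Covered x y) : (D.flip h).Covered y x where
  edge := Or.inr ⟨rfl, rfl⟩
  parents p hp := by
    have hxy := h.edge.ne
    have := h.edge.asymm
    by_cases hpx : p = x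
    · subst hpx
      have : ¬ D.Edge p p := fun h => h.ne rfl
      simp [flip_edge, hxy, this]
    · have := h.parents p hpx
      simp [flip_edge, hp, hpx, this]

theorem flip_flip_edge {D : DAG N} {x y : N} (h : D.Covered x y) (a b : N) :
    ((D.flip h).flip h.flip).Edge a b ↔ D.Edge a b := by
  have h1 := h.edge
  have h2 := h.edge.asymm
  rw [flip_edge, flip_edge]
  by_cases ha : a = x ∧ b = y
  · obtain ⟨rfl, rfl⟩ := ha
    simp [h1]
  · by_cases hb : a = y ∧ b = x
    · obtain ⟨rfl, rfl⟩ := hb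
      have := h1.ne
      have := this.symm
      simp [h2, this]
    · tauto

theorem Step.congr {D D' : DAG N} (h : ∀ a b, D.Edge a b ↔ D'.Edge a b) (S : Set N) :
    D.Step S = D'.Step S := by
  funext s t
  simp only [Step, h]

theorem Active.congr {D D' : DAG N} (h : ∀ a b, D.Edge a b ↔ D'.Edge a b) {S : Set N} {a b : N} :
    D.Active S a b ↔ D'.Active S a b := by
  unfold Active Reach
  rw [Step.congr h]

theorem markovEquivalent_of_active {D D' : DAG N}
    (h : ∀ S a b, D.Active S a b ↔ D'.Active S a b) : D.MarkovEquivalent D' := by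
  intro A B S
  simp only [dSep_iff, h]

/-- What reaching a state in `D` yields after reversal of the covered edge `x → y`. -/
theorem Covered.reach_flip {D : DAG N} {x y : N} (h : D.Covered x y) {S : Set N} {a : N}
    {t : N × Bool} (ht : D.Reach S a t) :
    let R := (D.flip h).Reach S a
    let α := R (x, true) ∧ R (y, true)
    (t.1 ≠ x → t.1 ≠ y → R t) ∧
    (t = (x, true) → α) ∧
    (t = (x, false) → R (x, false) ∨ (α ∧ y ∈ S) ∨ (R (y, false) ∧ y ∉ S)) ∧
    (t = (y, true) → α ∨ (R (x, false) ∧ x ∉ S) ∨ (R (y, false) ∧ y ∉ S)) ∧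
    (t = (y, false) → R (y, false)) := by
  intro R α
  have hxy := h.edge.ne
  have e0 : (D.flip h).Edge y x := Or.inr ⟨rfl, rfl⟩
  have e1 : ∀ {a b}, D.Edge a b → (a ≠ x ∨ b ≠ y) → (D.flip h).Edge a b :=
    fun h hne => Or.inl ⟨h, fun hh => hne.elim (fun h => h hh.1) fun h => h hh.2⟩
  have e2 : ∀ {p}, p ≠ x → D.Edge p y → (D.flip h).Edge p x :=
    fun hp hpy => e1 ((h.parents _ hp).1 hpy) (Or.inr hxy)
  have e3 : ∀ {p}, D.Edge p x → (D.flip h).Edge p y :=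
    fun hp => e1 ((h.parents _ hp.ne).2 hp) (Or.inl hp.ne)
  have down : ∀ {v w m}, R (v, m) → (D.flip h).Edge v w → v ∉ S → R (w, true) :=
    fun hr he hv => hr.tail (Step.down _ he hv)
  have up : ∀ {v w}, R (v, false) → (D.flip h).Edge w v → v ∉ S → R (w, false) :=
    fun hr he hv => hr.tail (Step.up he hv)
  have col : ∀ {v w}, R (v, true) → (D.flip h).Edge w v → v ∈ S → R (w, false) :=
    fun hr he hv => hr.tail (Step.collide he hv)
  -- The other parents of `x` and `y` coincide, so a ball that drops on one of them from a third
  -- node also drops on the other; this is `α`. The further alternatives cover a ball that crosses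
  -- the reversed edge.
  induction ht with
  | refl =>
    refine ⟨fun _ _ => .refl, by simp, ?_, by simp, ?_⟩
    · intro h; exact Or.inl (h ▸ .refl)
    · intro h; exact h ▸ .refl
  | @tail s t _ hst ih =>
    obtain ⟨v, m⟩ := s
    obtain ⟨w, m'⟩ := t
    have hst := step_cases hst
    simp only [Prod.mk.injEq] at ih ⊢
    obtain ⟨i1, i2, i3, i4, i5⟩ := ih
    rcases hst with ⟨rfl, hvw, hv⟩ | ⟨rfl, hwv, rfl, hv⟩ | ⟨rfl, hwv, rfl, hv⟩
    · -- downward moves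
      by_cases hvx : v = x
      · subst hvx
        have hwv : w ≠ v := hvw.ne.symm
        have key : α ∨ (R (v, false)) ∨ (R (y, false) ∧ y ∉ S) := by
          cases m
          · exact (i3 ⟨rfl, rfl⟩).elim (fun k => .inr (.inl k)) fun k =>
            k.elim (fun k => .inl k.1) fun k => .inr (.inr k)
          · exact Or.inl (i2 ⟨rfl, rfl⟩)
        refine ⟨fun _ hwy => ?_, by simp [hwv], by simp,
          fun _ => key.imp_right (Or.imp_left fun k => ⟨k, hv⟩), by simp⟩
        rcases key with k | k | k
        · exact down k.1 (e1 hvw (Or.inr hwy)) hv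
        · exact down k (e1 hvw (Or.inr hwy)) hv
        · exact down (down k.1 e0 k.2) (e1 hvw (Or.inr hwy)) hv
      by_cases hvy : v = y
      · subst hvy
        have hwv : w ≠ v := hvw.ne.symm
        have hwx : w ≠ x := by rintro rfl; exact h.edge.asymm hvw
        refine ⟨fun _ _ => ?_, by simp [hwx], by simp, by simp [hwv], by simp⟩
        have key : ∃ m, R (v, m) := by
          cases m
          · exact ⟨_, i5 ⟨rfl, rfl⟩⟩
          · rcases i4 ⟨rfl, rfl⟩ with k | k | k
            · exact ⟨_, k.2⟩
            · exact ⟨_, up k.1 e0 k.2⟩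
            · exact ⟨_, k.1⟩
        obtain ⟨m, k⟩ := key
        exact down k (e1 hvw (Or.inl hvx)) hv
      · have hr := i1 hvx hvy
        have hD : ∀ {u}, (D.flip h).Edge v u → R (u, true) := fun he => down hr he hv
        refine ⟨fun _ _ => hD (e1 hvw (Or.inl hvx)), ?_, by simp, ?_, by simp⟩
        · rintro ⟨rfl, -⟩
          exact ⟨hD (e1 hvw (Or.inl hvx)), hD (e3 hvw)⟩
        · rintro ⟨rfl, -⟩
          exact Or.inl ⟨hD (e2 hvx hvw), hD (e1 hvw (Or.inl hvx))⟩
    · -- upward moves through noncolliders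
      by_cases hvx : v = x
      · subst hvx
        have hwy : w ≠ y := by rintro rfl; exact h.edge.asymm hwv
        refine ⟨fun _ _ => ?_, by simp, by simp [hwv.ne], by simp, by simp [hwy]⟩
        rcases i3 ⟨rfl, rfl⟩ with k | k | k
        · exact up k (e1 hwv (Or.inr hxy)) hv
        · exact col k.1.2 (e3 hwv) k.2
        · exact up k.1 (e3 hwv) k.2
      by_cases hvy : v = y
      · subst hvy
        have k := i5 ⟨rfl, rfl⟩
        refine ⟨fun hwx _ => up k (e1 hwv (Or.inl hwx)) hv, by simp, fun _ => ?_, by simp,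
          by simp [hwv.ne]⟩
        exact Or.inr (Or.inr ⟨k, hv⟩)
      · have hr := up (i1 hvx hvy) (e1 hwv (Or.inr hvy)) hv
        refine ⟨fun _ _ => hr, by simp, ?_, by simp, ?_⟩
        · rintro ⟨rfl, -⟩; exact Or.inl hr
        · rintro ⟨rfl, -⟩; exact hr
    · -- upward moves through colliders
      by_cases hvx : v = x
      · subst hvx
        have hwy : w ≠ y := by rintro rfl; exact h.edge.asymm hwv
        exact ⟨fun _ _ => col (i2 ⟨rfl, rfl⟩).1 (e1 hwv (Or.inr hxy)) hv, by simp,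
          by simp [hwv.ne], by simp, by simp [hwy]⟩
      by_cases hvy : v = y
      · subst hvy
        have k := i4 ⟨rfl, rfl⟩
        refine ⟨fun hwx _ => ?_, by simp, fun _ => k.elim (fun k => .inr (.inl ⟨k, hv⟩)) fun k =>
          k.elim (fun k => .inl k.1) fun k => .inr (.inr k), by simp, by simp [hwv.ne]⟩
        rcases k with k | k | k
        · exact col k.2 (e1 hwv (Or.inl hwx)) hv
        · exact up k.1 (e2 hwx hwv) k.2
        · exact absurd hv k.2
      · have hr := col (i1 hvx hvy) (e1 hwv (Or.inr hvy)) hv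
        refine ⟨fun _ _ => hr, by simp, ?_, by simp, ?_⟩
        · rintro ⟨rfl, -⟩; exact Or.inl hr
        · rintro ⟨rfl, -⟩; exact hr

theorem Covered.active_flip {D : DAG N} {x y : N} (h : D.Covered x y) {S : Set N} {a b : N}
    (hab : D.Active S a b) : (D.flip h).Active S a b := by
  obtain ⟨m, hm⟩ := hab
  obtain ⟨i1, i2, i3, i4, i5⟩ := h.reach_flip hm
  have e0 : (D.flip h).Edge y x := Or.inr ⟨rfl, rfl⟩
  by_cases hbx : b = x
  · subst hbx
    cases m
    · rcases i3 rfl with k | k | k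
      · exact ⟨_, k⟩
      · exact ⟨_, k.1.1⟩
      · exact ⟨_, k.1.tail (Step.down _ e0 k.2)⟩
    · exact ⟨_, (i2 rfl).1⟩
  by_cases hby : b = y
  · subst hby
    cases m
    · exact ⟨_, i5 rfl⟩
    · rcases i4 rfl with k | k | k
      · exact ⟨_, k.2⟩
      · exact ⟨_, k.1.tail (Step.up e0 k.2)⟩
      · exact ⟨_, k.1⟩
  · exact ⟨_, i1 hbx hby⟩

theorem Covered.markovEquivalent_flip {D : DAG N} {x y : N} (h : D.Covered x y) :
    D.MarkovEquivalent (D.flip h) := by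
  refine markovEquivalent_of_active fun S a b => ⟨h.active_flip, fun h' => ?_⟩
  exact (Active.congr (flip_flip_edge h)).1 (h.flip.active_flip h')

/-- The edges that have different directions in `D` and `D'`. -/
def diff (D D' : DAG N) : Set (N × N) := {e | D.Edge e.1 e.2 ∧ D'.Edge e.2 e.1}

theorem wellFounded_transGen [Finite N] (D : DAG N) : WellFounded (Relation.TransGen D.Edge) :=
  haveI : Std.Irrefl (Relation.TransGen D.Edge) := ⟨D.acyclic⟩
  Finite.wellFounded_of_trans_of_irrefl _

theorem wellFounded_swap_transGen [Finite N] (D : DAG N) :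
    WellFounded (Function.swap (Relation.TransGen D.Edge)) :=
  haveI : Std.Irrefl (Function.swap (Relation.TransGen D.Edge)) := ⟨D.acyclic⟩
  haveI : IsTrans N (Function.swap (Relation.TransGen D.Edge)) := ⟨fun _ _ _ h h' => h'.trans h⟩
  Finite.wellFounded_of_trans_of_irrefl _

/-- Take `y` first in `D` among the heads of reversed edges, and `x` last among the tails of those
into `y`. A violation of coveredness would give an unshielded collider in only one DAG, a cycle, or
a reversed edge contradicting one of these choices. -/
theorem SameVStruct.exists_covered [Finite N] {D D' : DAG N} (h : D.SameVStruct D')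
    (hne : (D.diff D').Nonempty) : ∃ x y, D.Covered x y ∧ D'.Edge y x := by
  obtain ⟨⟨x0, y0⟩, hxy0⟩ := hne
  obtain ⟨y, ⟨x1, hx1⟩, hy⟩ := D.wellFounded_transGen.has_min
    {y | ∃ x, D.Edge x y ∧ D'.Edge y x} ⟨y0, x0, hxy0⟩
  obtain ⟨x, ⟨hxy, hyx⟩, hx⟩ := D.wellFounded_swap_transGen.has_min
    {x | D.Edge x y ∧ D'.Edge y x} ⟨x1, hx1⟩
  refine ⟨x, y, ⟨hxy, fun p hp => ⟨fun hpy => ?_, fun hpx => ?_⟩⟩, hyx⟩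
  · have hadj : D.Adjacent p x := by
      by_contra hn
      exact hyx.asymm ((h.collider p y x hp hn).1 ⟨hpy, hxy⟩).2
    refine hadj.resolve_right fun hxp => ?_
    have hpy' : D'.Edge p y := by
      refine ((h.adj p y).1 (Or.inl hpy)).resolve_right fun hyp => ?_
      exact hx p ⟨hpy, hyp⟩ (.single hxp)
    have hpx' : D'.Edge p x :=
      ((h.adj p x).1 hadj).resolve_right fun h' =>
        D'.acyclic p (((Relation.TransGen.single hpy').tail hyx).tail h')
    exact hy p ⟨x, hxp, hpx'⟩ (.single hpy)
  · have hpx' : D'.Edge p x := by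
      refine ((h.adj p x).1 (Or.inl hpx)).resolve_right fun hxp => ?_
      exact hy x ⟨p, hpx, hxp⟩ (.single hxy)
    have hpy : p ≠ y := by rintro rfl; exact hxy.asymm hpx
    have hadj : D.Adjacent p y := by
      by_contra hn
      exact hxy.asymm ((h.collider p x y hpy hn).2 ⟨hpx', hyx⟩).2
    exact hadj.resolve_right fun hyp =>
      D.acyclic p (((Relation.TransGen.single hpx).tail hxy).tail hyp)

/-- DAGs with the same adjacencies and unshielded colliders are Markov equivalent. -/
theorem SameVStruct.markovEquivalent [Finite N] {D D' : DAG N} (h : D.SameVStruct D') :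
    D.MarkovEquivalent D' := by
  induction hn : (D.diff D').ncard using Nat.strong_induction_on generalizing D with
  | _ n ih =>
    subst hn
    rcases (D.diff D').eq_empty_or_nonempty with he | hne
    · have key : ∀ a b, D.Edge a b → ¬ D'.Edge b a := fun a b hab hba =>
        (Set.eq_empty_iff_forall_notMem.1 he) (a, b) ⟨hab, hba⟩
      have : ∀ a b, D.Edge a b ↔ D'.Edge a b := fun a b =>
        ⟨fun hab => ((h.adj a b).1 (Or.inl hab)).resolve_right (key a b hab),
          fun hab => ((h.adj a b).2 (Or.inl hab)).resolve_right fun hba => key b a hba hab⟩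
      exact markovEquivalent_of_active fun _ _ _ => Active.congr this
    · obtain ⟨x, y, hc, hyx⟩ := h.exists_covered hne
      have hm := hc.markovEquivalent_flip
      refine hm.trans (ih _ ?_ (hm.symm.sameVStruct.trans h) rfl)
      refine Set.ncard_lt_ncard ⟨?_, fun hss => ?_⟩ (Set.toFinite _)
      · rintro ⟨a, b⟩ ⟨hab, hba⟩
        rcases hab with ⟨hab, -⟩ | ⟨rfl, rfl⟩
        · exact ⟨hab, hba⟩
        · exact absurd hba hyx.asymm
      · exact (hss (show (x, y) ∈ D.diff D' from ⟨hc.edge, hyx⟩)).1.asymm (Or.inr ⟨rfl, rfl⟩)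

end DAG

/-! ### Meek's rules and the chain graph property -/

namespace DAG

variable {N : Type u}

/-- The edges of `D` whose direction is forced by the unshielded colliders via Meek's rules. -/
inductive Meek (D : DAG N) : N → N → Prop
  | collider {a b w : N} : D.Edge a b → D.Edge w b → a ≠ w → ¬ D.Adjacent a w → Meek D a b
  | away {w a b : N} : Meek D w a → D.Edge a b → w ≠ b → ¬ D.Adjacent w b → Meek D a b
  | acyclic {a w b : N} : Meek D a w → Meek D w b → D.Adjacent a b → Meek D a b
  | kite {a b v w : N} : Meek D v b → Meek D w b → v ≠ w → ¬ D.Adjacent v w → D.Adjacent a b →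
      D.Adjacent a v → D.Adjacent a w → ¬ (D.Edge v a ∧ D.Edge w a) → Meek D a b

/-- Soundness of the rules: the opposite direction would create a cycle or an unshielded collider
absent from `D`. For `kite`, `b → a` forces `v → a ← w` by acyclicity. -/
theorem Meek.edge_of_sameVStruct {D D' : DAG N} {a b : N} (hm : D.Meek a b)
    (h : D.SameVStruct D') : D'.Edge a b := by
  induction hm with
  | collider hab hwb hne hn => exact ((h.collider _ _ _ hne hn).1 ⟨hab, hwb⟩).1
  | @away w a b _ hab hwb hn ih =>
    refine ((h.adj a b).1 (Or.inl hab)).resolve_right fun hba => ?_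
    exact hab.asymm ((h.collider w a b hwb hn).2 ⟨ih, hba⟩).2
  | acyclic _ _ hadj ih1 ih2 =>
    refine ((h.adj _ _).1 hadj).resolve_right fun hba => ?_
    exact D'.acyclic _ (((Relation.TransGen.single ih1).tail ih2).tail hba)
  | @kite a b v w _ _ hne hn hadj hav haw hncol ih1 ih2 =>
    refine ((h.adj _ _).1 hadj).resolve_right fun hba => ?_
    refine hncol ((h.collider v a w hne hn).2 ⟨?_, ?_⟩)
    · exact ((h.adj _ _).1 hav).resolve_left fun hh =>
        D'.acyclic _ (((Relation.TransGen.single hh).tail ih1).tail hba)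
    · exact ((h.adj _ _).1 haw).resolve_left fun hh =>
        D'.acyclic _ (((Relation.TransGen.single hh).tail ih2).tail hba)

theorem SameVStruct.refl (D : DAG N) : D.SameVStruct D :=
  ⟨fun _ _ => Iff.rfl, fun _ _ _ _ _ => Iff.rfl⟩

theorem Meek.edge {D : DAG N} {a b : N} (h : D.Meek a b) : D.Edge a b :=
  h.edge_of_sameVStruct (.refl D)

/-- The adjacencies whose direction is not forced by Meek's rules. -/
def Free (D : DAG N) (a b : N) : Prop := D.Adjacent a b ∧ ¬ D.Meek a b ∧ ¬ D.Meek b a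

theorem Free.symm {D : DAG N} {a b : N} (h : D.Free a b) : D.Free b a :=
  ⟨h.1.symm, h.2.2, h.2.1⟩

theorem Free.ne {D : DAG N} {a b : N} (h : D.Free a b) : a ≠ b := h.1.ne

theorem Meek.adjacent_of_free {D : DAG N} {a b c : N} (h : D.Meek a b) (hbc : D.Free b c) :
    D.Adjacent a c := by
  by_contra hn
  have hac : a ≠ c := by rintro rfl; exact hbc.2.2 h
  rcases hbc.1 with h' | h'
  · exact hbc.2.1 (.away h h' hac hn)
  · exact hbc.2.2 (.collider h' h.edge hac.symm fun hh => hn hh.symm)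

/-- Meek's rules yield a chain graph. -/
theorem Meek.trans_free {D : DAG N} {a b c : N} (h : D.Meek a b) (hbc : D.Free b c) :
    D.Meek a c := by
  induction h generalizing c with
  | @collider a b w hab hwb hne hn =>
    have ha := (Meek.collider hab hwb hne hn).adjacent_of_free hbc
    have hw := (Meek.collider hwb hab hne.symm fun h => hn h.symm).adjacent_of_free hbc
    by_cases hcol : D.Edge a c ∧ D.Edge w c
    · exact .collider hcol.1 hcol.2 hne hn
    · exact absurd (Meek.kite (.collider hab hwb hne hn)
        (.collider hwb hab hne.symm fun h => hn h.symm) hne hn hbc.1.symm ha.symm hw.symm hcol)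
        hbc.2.2
  | @away w a b hwa hab hwb hn ih =>
    have ha := (Meek.away hwa hab hwb hn).adjacent_of_free hbc
    -- If `a` and `c` were not forced as claimed, then `c → a` would force `c → b`; and if the edge
    -- is free, induction gives `w → c`, which forces the edge between `b` and `c` as `w` and `b`
    -- are nonadjacent.
    by_contra hac
    by_cases hca : D.Meek c a
    · exact hbc.2.2 (.acyclic hca (.away hwa hab hwb hn) hbc.1.symm)
    have hwc := ih ⟨ha, hac, hca⟩
    rcases hbc.1 with h | h
    · exact hbc.2.1 (.collider h hwc.edge hwb.symm fun h => hn h.symm)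
    · exact hbc.2.2 (.away hwc h hwb hn)
  | @acyclic a w b haw hwb hab ih1 ih2 =>
    exact .acyclic haw (ih2 hbc) ((Meek.acyclic haw hwb hab).adjacent_of_free hbc)
  | @kite a b v w hvb hwb hne hn hab hav haw hcol ih1 ih2 =>
    exact .kite (ih1 hbc) (ih2 hbc) hne hn
      ((Meek.kite hvb hwb hne hn hab hav haw hcol).adjacent_of_free hbc) hav haw hcol

end DAG

/-! ### Perfect orderings and cliques -/

/-- The list of nodes, read backwards, is a perfect ordering for the relation `r`: the neighbours
of a node that come after it in the list form a clique. -/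
def PerfectList {N : Type u} (r : N → N → Prop) : List N → Prop
  | [] => True
  | v :: l => (∀ a ∈ l, ∀ b ∈ l, r v a → r v b → a ≠ b → r a b) ∧ PerfectList r l

namespace PerfectList

variable {N : Type u} {r : N → N → Prop}

theorem append_congr {l₁ l₂ l₃ : List N} (h : PerfectList r (l₁ ++ l₂))
    (h₃ : PerfectList r l₃)
    (hn : ∀ v ∈ l₁, ∀ a ∈ l₃, r v a → a ∈ l₂) : PerfectList r (l₁ ++ l₃) := by
  induction l₁ with
  | nil => exact h₃
  | cons v l ih =>
    refine ⟨fun a ha b hb hva hvb hab => ?_, ih h.2 fun u hu => hn u (List.mem_cons_of_mem _ hu)⟩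
    have key : ∀ c ∈ l ++ l₃, r v c → c ∈ l ++ l₂ := fun c hc hvc => by
      rcases List.mem_append.1 hc with hc | hc
      · exact List.mem_append_left _ hc
      · exact List.mem_append_right _ (hn v (by simp) c hc hvc)
    exact h.1 a (key a ha hva) b (key b hb hvb) hva hvb hab

theorem of_clique {l : List N} (h : ∀ a ∈ l, ∀ b ∈ l, a ≠ b → r a b) : PerfectList r l := by
  induction l with
  | nil => trivial
  | cons v l ih =>
    exact ⟨fun a ha b hb _ _ => h a (by simp [ha]) b (by simp [hb]),
      ih fun a ha b hb => h a (by simp [ha]) b (by simp [hb])⟩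

/-- Every clique can be moved to the end of a perfect list. -/
theorem exists_append (hr : ∀ a b, r a b → r b a) {l : List N} (h : PerfectList r l)
    (hl : l.Nodup) {k : List N} (hk : k.Nodup) (hkl : k ⊆ l)
    (hc : ∀ a ∈ k, ∀ b ∈ k, a ≠ b → r a b) :
    ∃ q, PerfectList r (q ++ k) ∧ (q ++ k).Perm l := by
  classical
  induction l generalizing k with
  | nil =>
    obtain rfl : k = [] := List.subset_nil.1 hkl
    exact ⟨[], trivial, .refl _⟩
  | cons v l ih =>
    obtain ⟨hv, hl⟩ := List.nodup_cons.1 hl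
    by_cases hvk : v ∈ k
    -- Since `v` lies in the clique `k`, the rest of `k` consists of neighbours of `v`. These form a
    -- clique, which is moved to the end first. Together with `v` it is still a clique, so it can be
    -- rearranged with `k` last; no node of `q` is a neighbour of `v`.
    · obtain ⟨q, hq, hp⟩ := ih h.2 hl (k := l.filter (fun a => r v a)) (hl.filter _)
        (fun _ => List.mem_of_mem_filter) (by
          intro a ha b hb hab
          simp only [List.mem_filter, decide_eq_true_eq] at ha hb
          exact h.1 a ha.1 b hb.1 ha.2 hb.2 hab)
      have hnd : (q ++ l.filter (fun a => r v a)).Nodup := hp.nodup_iff.2 hl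
      have hmem : ∀ a, a ∈ q ∨ (a ∈ l ∧ r v a) ↔ a ∈ l := fun a => by
        simpa using hp.mem_iff (a := a)
      have hdis : ∀ a ∈ q, ¬ r v a := fun a ha hva =>
        (List.disjoint_of_nodup_append hnd) ha (by simp [(hmem a).1 (Or.inl ha), hva])
      have hkr : ∀ a ∈ k, a = v ∨ (a ∈ l ∧ r v a) := fun a ha => by
        by_cases hav : a = v
        · exact Or.inl hav
        · exact Or.inr ⟨(List.mem_cons.1 (hkl ha)).resolve_left hav,
            hc v hvk a ha (Ne.symm hav)⟩
      refine ⟨q ++ (l.filter (fun a => r v a)).filter (fun a => a ∉ k), ?_, ?_⟩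
      · rw [List.append_assoc]
        refine hq.append_congr (of_clique ?_) ?_
        · have key : ∀ a ∈ (l.filter (fun a => r v a)).filter (fun a => a ∉ k) ++ k,
              a = v ∨ (a ∈ l ∧ r v a) := by
            intro a ha
            rcases List.mem_append.1 ha with ha | ha
            · right
              simp only [List.mem_filter, decide_eq_true_eq] at ha
              exact ha.1
            · exact hkr a ha
          intro a ha b hb hab
          rcases key a ha with rfl | ha
          · rcases key b hb with rfl | hb
            · exact absurd rfl hab
            · exact hb.2
          · rcases key b hb with rfl | hb
            · exact hr _ _ ha.2
            · exact h.1 a ha.1 b hb.1 ha.2 hb.2 hab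
        · intro u hu a ha hua
          rcases List.mem_append.1 ha with ha | ha
          · exact List.mem_of_mem_filter ha
          · rcases hkr a ha with rfl | ha
            · exact absurd (hr _ _ hua) (hdis u hu)
            · simpa using ha
      · refine (List.perm_ext_iff_of_nodup ?_ (List.nodup_cons.2 ⟨hv, hl⟩)).2 fun a => ?_
        · rw [List.append_assoc, List.nodup_append']
          have h1 := List.nodup_append'.1 hnd
          refine ⟨h1.1, List.nodup_append'.2 ⟨h1.2.1.filter _, hk, ?_⟩, ?_⟩
          · intro a ha hak
            simp [hak] at ha
          · intro a haq ha
            rcases List.mem_append.1 ha with ha | ha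
            · exact h1.2.2 haq (List.mem_of_mem_filter ha)
            · rcases hkr a ha with rfl | ha
              · exact hv ((hmem a).1 (Or.inl haq))
              · exact hdis a haq ha.2
        · by_cases hak : a ∈ k
          · simp only [List.mem_append, hak, or_true, true_iff]
            exact hkl hak
          · simp only [List.mem_append, List.mem_filter, hak, decide_eq_true_eq,
              and_true, or_false, List.mem_cons, decide_not,
              decide_false, Bool.not_false]
            rw [hmem a]
            refine ⟨Or.inr, fun h => h.resolve_left ?_⟩
            rintro rfl
            exact hak hvk
    · have hkl' : k ⊆ l := fun a ha => (List.mem_cons.1 (hkl ha)).resolve_left (by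
        rintro rfl; exact hvk ha)
      obtain ⟨q, hq, hp⟩ := ih h.2 hl hk hkl' hc
      refine ⟨v :: q, ⟨fun a ha b hb => h.1 a (hp.mem_iff.1 ha) b (hp.mem_iff.1 hb), hq⟩, ?_⟩
      exact hp.cons v

theorem rel_of_idxOf [DecidableEq N] {l : List N} (h : PerfectList r l) {v a b : N}
    (hva : l.idxOf v < l.idxOf a) (hvb : l.idxOf v < l.idxOf b) (ha : a ∈ l) (hb : b ∈ l)
    (hra : r v a) (hrb : r v b) (hab : a ≠ b) : r a b := by
  induction l with
  | nil => simp at ha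
  | cons u l ih =>
    have hau : u ≠ a := by rintro rfl; simp at hva
    have hbu : u ≠ b := by rintro rfl; simp at hvb
    have ha' : a ∈ l := (List.mem_cons.1 ha).resolve_left hau.symm
    have hb' : b ∈ l := (List.mem_cons.1 hb).resolve_left hbu.symm
    by_cases huv : u = v
    · subst huv
      exact h.1 a ha' b hb' hra hrb hab
    · rw [List.idxOf_cons_ne _ huv, List.idxOf_cons_ne _ hau] at hva
      rw [List.idxOf_cons_ne _ huv, List.idxOf_cons_ne _ hbu] at hvb
      exact ih h.2 (by omega) (by omega) ha' hb'

end PerfectList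

/-! ### Reversing an unforced edge within the Markov equivalence class -/

namespace DAG

variable {N : Type u}

theorem exists_list_sinks_first [Finite N] (D : DAG N) (s : Finset N) :
    ∃ l : List N, l.Nodup ∧ (∀ a, a ∈ l ↔ a ∈ s) ∧ l.Pairwise fun v a => ¬ D.Edge v a := by
  classical
  induction s using Finset.strongInduction with
  | H s ih =>
    rcases s.eq_empty_or_nonempty with rfl | ⟨x, hx⟩
    · exact ⟨[], by simp⟩
    obtain ⟨v, hv, hmin⟩ := D.wellFounded_swap_transGen.has_min {v | v ∈ s} ⟨x, hx⟩
    obtain ⟨l, h1, h2, h3⟩ := ih (s.erase v) (Finset.erase_ssubset hv)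
    refine ⟨v :: l, List.nodup_cons.2 ⟨by simp [h2], h1⟩, fun a => ?_, List.pairwise_cons.2
      ⟨fun a ha hva => hmin a ?_ (.single hva), h3⟩⟩
    · simp only [List.mem_cons, h2, Finset.mem_erase]
      by_cases hav : a = v
      · simpa [hav] using hv
      · simp [hav]
    · exact Finset.mem_of_mem_erase ((h2 a).1 ha)

/-- If `a` and `c` were nonadjacent, the collider would be forced; a forced direction between them
would propagate to `b` by `trans_free`. -/
theorem free_of_free_of_free {D : DAG N} {a b c : N} (hab : D.Edge a b) (hcb : D.Edge c b)
    (hac : a ≠ c) (ha : D.Free b a) (hc : D.Free b c) : D.Free a c := by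
  refine ⟨?_, fun h => ?_, fun h => ?_⟩
  · by_contra hn
    exact ha.2.2 (.collider hab hcb hac hn)
  · exact ha.2.2 (h.trans_free hc.symm)
  · exact hc.2.2 (h.trans_free ha.symm)

/-- With sinks first, the free neighbours of a node that come later are its parents. -/
theorem perfectList_of_pairwise {D : DAG N} {l : List N}
    (h : l.Pairwise fun v a => ¬ D.Edge v a) : PerfectList D.Free l := by
  induction l with
  | nil => trivial
  | cons v l ih =>
    obtain ⟨h1, h2⟩ := List.pairwise_cons.1 h
    exact ⟨fun a ha b hb hva hvb hab => free_of_free_of_free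
      (hva.1.resolve_left (h1 a ha)) (hvb.1.resolve_left (h1 b hb)) hab hva hvb, ih h2⟩

theorem transGen_meek_trans_free {D : DAG N} {a b c : N} (h : Relation.TransGen D.Meek a b)
    (hbc : D.Free b c) : Relation.TransGen D.Meek a c := by
  cases h with
  | single h => exact .single (h.trans_free hbc)
  | tail h h' => exact .tail h (h'.trans_free hbc)

/-- Every edge that is not forced by Meek's rules is reversed in some Markov equivalent DAG. -/
theorem exists_markovEquivalent_edge [Finite N] {D : DAG N} {a b : N} (hab : D.Free a b) :
    ∃ D' : DAG N, D.MarkovEquivalent D' ∧ D'.Edge b a := by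
  classical
  have := Fintype.ofFinite N
  obtain ⟨l, hnd, hmem, hp⟩ := D.exists_list_sinks_first Finset.univ
  -- With `b` last, directing free edges from later to earlier nodes yields `b → a`.
  obtain ⟨q, hq, hperm⟩ := (perfectList_of_pairwise hp).exists_append (fun _ _ => Free.symm) hnd
    (k := [b]) (by simp) (by simp [hmem]) (by simp)
  set L := q ++ [b] with hL
  have hmemL : ∀ v, v ∈ L := fun v => hperm.mem_iff.2 (by simp [hmem])
  have hndL : L.Nodup := hperm.nodup_iff.2 hnd
  let E : N → N → Prop := fun u v => D.Meek u v ∨ (D.Free u v ∧ L.idxOf v < L.idxOf u)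
  -- A cycle with a forced edge shrinks to a cycle of forced edges, as free edges are absorbed; on a
  -- cycle of free edges the position in `L` would strictly decrease.
  have hE : ∀ {x y z}, D.Meek x y → Relation.ReflTransGen E y z → Relation.TransGen D.Meek x z := by
    intro x y z hxy hyz
    induction hyz with
    | refl => exact .single hxy
    | tail _ h ih =>
      rcases h with h | h
      · exact ih.tail h
      · exact transGen_meek_trans_free ih h.1
  have hcases : ∀ {u v}, Relation.TransGen E u v → L.idxOf v < L.idxOf u ∨
      ∃ x y, Relation.ReflTransGen E u x ∧ D.Meek x y ∧ Relation.ReflTransGen E y v := by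
    intro u v huv
    induction huv with
    | single h =>
      rcases h with h | h
      · exact Or.inr ⟨_, _, .refl, h, .refl⟩
      · exact Or.inl h.2
    | tail huv h ih =>
      rcases ih with ih | ⟨x, y, h1, h2, h3⟩
      · rcases h with h | h
        · exact Or.inr ⟨_, _, huv.to_reflTransGen, h, .refl⟩
        · exact Or.inl (h.2.trans ih)
      · exact Or.inr ⟨x, y, h1, h2, h3.tail h⟩
  let D' : DAG N := ⟨⟨E⟩, fun v hv => by
    rcases hcases hv with h | ⟨x, y, h1, h2, h3⟩
    · exact lt_irrefl _ h
    · exact D.acyclic x (Relation.TransGen.mono (fun _ _ => Meek.edge) _ _ (hE h2 (h3.trans h1)))⟩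
  refine ⟨D', SameVStruct.markovEquivalent ⟨fun u v => ⟨fun huv => ?_, ?_⟩, fun u v w huw hn =>
    ⟨fun h => ?_, ?_⟩⟩, Or.inr ⟨hab.symm, ?_⟩⟩
  · by_cases h1 : D.Meek u v
    · exact Or.inl (Or.inl h1)
    by_cases h2 : D.Meek v u
    · exact Or.inr (Or.inl h2)
    have hf : D.Free u v := ⟨huv, h1, h2⟩
    rcases lt_or_gt_of_ne fun h => hf.ne ((List.idxOf_inj (hmemL u)).1 h) with h | h
    · exact Or.inr (Or.inr ⟨hf.symm, h⟩)
    · exact Or.inl (Or.inr ⟨hf, h⟩)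
  · rintro ((h | h) | (h | h))
    · exact Or.inl h.edge
    · exact h.1.1
    · exact Or.inr h.edge
    · exact h.1.1.symm
  · exact ⟨Or.inl (.collider h.1 h.2 huw hn),
      Or.inl (.collider h.2 h.1 huw.symm fun h => hn h.symm)⟩
  · rintro ⟨h | h, h' | h'⟩
    · exact ⟨h.edge, h'.edge⟩
    · exact absurd (h.adjacent_of_free h'.1.symm) hn
    · exact absurd (h'.adjacent_of_free h.1.symm).symm hn
    · exact absurd (hq.rel_of_idxOf h.2 h'.2 (hmemL u) (hmemL w) h.1.symm h'.1.symm huw).1 hn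
  · have haq : a ∈ q := by simpa [hL, hab.ne] using hmemL a
    have hbq : b ∉ q := fun hb => by
      simpa using (List.nodup_append'.1 hndL).2.2 hb
    rw [hL, List.idxOf_append_of_mem haq, List.idxOf_append_of_notMem hbq]
    have := List.idxOf_lt_length_iff.2 haq
    omega

end DAG

/-! ### CPDAGs as chain graphs -/

theorem exists_nodup_isChain {N : Type u} {r : N → N → Prop} {x y : N}
    (h : Relation.ReflTransGen r x y) :
    ∃ l : List N, (x :: l).Nodup ∧ (x :: l).IsChain r ∧ (x :: l).getLast? = some y := by
  induction h using Relation.ReflTransGen.head_induction_on with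
  | refl => exact ⟨[], by simp⟩
  | @head a b hab _ ih =>
    obtain ⟨l, h1, h2, h3⟩ := ih
    by_cases ha : a ∈ b :: l
    · obtain ⟨q, t, hqt⟩ := List.append_of_mem ha
      have hsuf : (a :: t) <:+ (b :: l) := ⟨q, hqt.symm⟩
      refine ⟨t, h1.sublist hsuf.sublist, h2.suffix hsuf, ?_⟩
      rw [← h3, hqt]
      simp [List.getLast?_append, List.getLast?_cons]
    · exact ⟨b :: l, List.nodup_cons.2 ⟨ha, h1⟩, List.isChain_cons_cons.2 ⟨hab, h2⟩,
        by rw [List.getLast?_cons_cons, h3]⟩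

theorem reflTransGen_of_isChain {N : Type u} {r : N → N → Prop} (l : List N) {x y : N}
    (h : (x :: l).IsChain r) (hy : (x :: l).getLast? = some y) : Relation.ReflTransGen r x y := by
  induction l generalizing x with
  | nil =>
    obtain rfl : x = y := by simpa using hy
    exact .refl
  | cons z l ih =>
    rw [List.isChain_cons_cons] at h
    rw [List.getLast?_cons_cons] at hy
    exact (ih h.2 hy).head h.1

namespace MixedGraph

variable {N : Type u}

namespace IsCPDAGOf

variable {G : MixedGraph N} {D : DAG N}

theorem edge (h : G.IsCPDAGOf D) {a b : N} (hab : G.Dir a b) : D.Edge a b :=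
  (h.1 a b).1 hab D (.refl D)

theorem dir_or_undir (h : G.IsCPDAGOf D) {a b : N} (hab : D.Edge a b) :
    G.Dir a b ∨ G.Undir a b := by
  by_cases hd : G.Dir a b
  · exact Or.inl hd
  right
  rw [h.1] at hd
  push Not at hd
  obtain ⟨D', hD', hn⟩ := hd
  exact (h.2 a b).2 ⟨⟨D, .refl D, hab⟩, D', hD', (hD'.adjacent (Or.inl hab)).resolve_left hn⟩

theorem adjacent (h : G.IsCPDAGOf D) {a b : N} (hab : G.Undir a b) : D.Adjacent a b := by
  obtain ⟨D', hD', h'⟩ := ((h.2 a b).1 hab).1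
  exact hD'.symm.adjacent (Or.inl h')

/-- Meek's rules are sound and complete, so the chain graph property passes to `G`. -/
theorem dir_iff [Finite N] (h : G.IsCPDAGOf D) {a b : N} : G.Dir a b ↔ D.Meek a b := by
  rw [h.1]
  refine ⟨fun hd => ?_, fun hm D' hD' => hm.edge_of_sameVStruct hD'.sameVStruct⟩
  by_contra hn
  have hab := hd D (.refl D)
  obtain ⟨D', hD', hba⟩ := DAG.exists_markovEquivalent_edge (D := D) (a := a) (b := b)
    ⟨Or.inl hab, hn, fun h' => hab.asymm h'.edge⟩
  exact hba.asymm (hd D' hD')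

theorem free [Finite N] (h : G.IsCPDAGOf D) {a b : N} (hab : G.Undir a b) : D.Free a b :=
  ⟨h.adjacent hab, fun hm => G.not_both a b (h.dir_iff.2 hm) hab,
    fun hm => G.not_both b a (h.dir_iff.2 hm) (G.undir_symm a b hab)⟩

theorem dir_trans_undir [Finite N] (h : G.IsCPDAGOf D) {a b c : N} (hab : G.Dir a b)
    (hbc : G.Undir b c) : G.Dir a c :=
  h.dir_iff.2 ((h.dir_iff.1 hab).trans_free (h.free hbc))

theorem dir_trans_reflTransGen [Finite N] (h : G.IsCPDAGOf D) {a b c : N} (hab : G.Dir a b)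
    (hbc : Relation.ReflTransGen G.Undir b c) : G.Dir a c := by
  induction hbc with
  | refl => exact hab
  | tail _ h' ih => exact h.dir_trans_undir ih h'

theorem transGen_trans_undir [Finite N] (h : G.IsCPDAGOf D) {a b c : N}
    (hab : Relation.TransGen G.Dir a b) (hbc : G.Undir b c) : Relation.TransGen G.Dir a c := by
  cases hab with
  | single h' => exact .single (h.dir_trans_undir h' hbc)
  | tail h1 h2 => exact .tail h1 (h.dir_trans_undir h2 hbc)

theorem transGen_trans_reflTransGen [Finite N] (h : G.IsCPDAGOf D) {a b c : N}
    (hab : Relation.TransGen G.Dir a b) (hbc : Relation.ReflTransGen G.Undir b c) :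
    Relation.TransGen G.Dir a c := by
  induction hbc with
  | refl => exact hab
  | tail _ h' ih => exact h.transGen_trans_undir ih h'

/-- A CPDAG has no partially directed cycles. -/
theorem not_transGen [Finite N] (h : G.IsCPDAGOf D) {a b : N}
    (hab : Relation.ReflTransGen G.Undir b a) : ¬ Relation.TransGen G.Dir a b := fun h' =>
  D.acyclic a (Relation.TransGen.mono (fun _ _ => h.edge) _ _ (h.transGen_trans_reflTransGen h' hab))

theorem undir_of_colliding [Finite N] (h : G.IsCPDAGOf D) {a b c : N} (hab : D.Edge a b)
    (hcb : D.Edge c b) (hac : a ≠ c) (ha : G.Undir b a) (hc : G.Undir b c) : G.Undir a c := by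
  have hf := DAG.free_of_free_of_free hab hcb hac (h.free ha) (h.free hc)
  rcases hf.1 with h' | h'
  · exact (h.dir_or_undir h').resolve_left fun hd => hf.2.1 (h.dir_iff.1 hd)
  · exact G.undir_symm _ _ ((h.dir_or_undir h').resolve_left fun hd => hf.2.2 (h.dir_iff.1 hd))

end IsCPDAGOf

/-! ### Amenability and separation of siblings from `Y` -/

theorem reflTransGen_undir_symm {G : MixedGraph N} {a b : N}
    (h : Relation.ReflTransGen G.Undir a b) : Relation.ReflTransGen G.Undir b a := by
  induction h with
  | refl => exact .refl
  | tail _ h' ih => exact ih.head (G.undir_symm _ _ h')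

/-- The edge from `a` to `b` avoids `x` and is not directed backwards. -/
def PossAvoiding (G : MixedGraph N) (x a b : N) : Prop :=
  (G.Dir a b ∨ G.Undir a b) ∧ a ≠ x ∧ b ≠ x

/-- A path violating amenability starts with an undirected edge and never returns to `x`.
Conversely, a walk avoiding `x` shortens to a path. -/
theorem amenable_iff {G : MixedGraph N} {x y : N} (hxy : x ≠ y) :
    G.Amenable x y ↔ ∀ v ∈ G.sib x, ¬ Relation.ReflTransGen (G.PossAvoiding x) v y := by
  constructor
  · intro h v hv hr
    obtain ⟨l, h1, h2, h3⟩ := exists_nodup_isChain hr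
    have hxl : x ∉ v :: l := by
      intro hx
      rcases List.mem_cons.1 hx with rfl | hx
      · exact G.undir_irrefl _ hv
      · obtain ⟨q, t, hqt⟩ := List.append_of_mem hx
        rcases List.eq_nil_or_concat (v :: q) with hq | ⟨q', z, hq⟩
        · simp at hq
        · have : [z, x] <:+: v :: l := ⟨q', t, by
            rw [hqt, ← List.cons_append, hq]; simp⟩
          exact (List.isChain_pair.1 (h2.infix this)).2.2 rfl
    have hchain : (x :: v :: l).IsChain fun a b => G.Dir a b ∨ G.Undir a b :=
      List.isChain_cons_cons.2 ⟨Or.inr hv, h2.imp fun _ _ h => h.1⟩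
    obtain ⟨b, ⟨t, ht⟩, hb⟩ := h (x :: v :: l) ⟨⟨List.nodup_cons.2 ⟨hxl, h1⟩,
      hchain.imp fun a b h => h.elim Or.inl fun h => Or.inr (Or.inr h), rfl,
      by rw [List.getLast?_cons_cons, h3]⟩, fun a b hab hba => by
        rcases List.isChain_pair.1 (hchain.infix hab) with h | h
        · exact G.dir_asymm _ _ h hba
        · exact G.not_both _ _ hba (G.undir_symm _ _ h)⟩
    obtain rfl : b = v := by simp at ht; exact ht.1
    exact G.not_both _ _ hb hv
  · rintro h p ⟨⟨h1, h2, h3, h4⟩, h5⟩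
    match p, h1, h2, h3, h4, h5 with
    | [], _, _, h3, _, _ => simp at h3
    | [z], _, _, h3, h4, _ =>
      simp at h3 h4
      exact absurd (h3.symm.trans h4) hxy
    | z :: b :: l, h1, h2, h3, h4, h5 =>
      obtain rfl : z = x := by simpa using h3
      refine ⟨b, ⟨l, rfl⟩, ?_⟩
      by_contra hn
      rw [List.isChain_cons_cons] at h2
      have hu : G.Undir z b := by
        rcases h2.1 with h | h | h
        · exact absurd h hn
        · exact absurd h (h5 z b ⟨[], l, rfl⟩)
        · exact h
      refine h b hu (reflTransGen_of_isChain l ?_ (by rwa [List.getLast?_cons_cons] at h4))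
      have hz := (List.nodup_cons.1 h1).1
      rw [List.isChain_iff_forall_rel_of_append_cons_cons] at h2 ⊢
      intro a c l₁ l₂ hl
      have ha : a ∈ b :: l := by rw [hl]; simp
      have hc : c ∈ b :: l := by rw [hl]; simp
      refine ⟨?_, fun h => hz (h ▸ ha), fun h => hz (h ▸ hc)⟩
      rcases h2.2 hl with h | h | h
      · exact Or.inl h
      · exact absurd h (h5 a c ⟨z :: l₁, l₂, by rw [hl]; simp⟩)
      · exact Or.inr h

/-- Follow the walk from its last visit to `x`. -/
theorem exists_undir_avoiding {G : MixedGraph N} {x w : N}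
    (h : Relation.ReflTransGen G.Undir x w) :
    w = x ∨ ∃ v, G.Undir x v ∧ Relation.ReflTransGen (G.PossAvoiding x) v w := by
  induction h with
  | refl => exact Or.inl rfl
  | @tail u w _ huw ih =>
    by_cases hw : w = x
    · exact Or.inl hw
    right
    by_cases hu : u = x
    · subst hu
      exact ⟨w, huw, .refl⟩
    · obtain ⟨v, hv, hr⟩ := ih.resolve_left hu
      exact ⟨v, hv, hr.tail ⟨Or.inr huw, hu, hw⟩⟩

variable {G : MixedGraph N} {D : DAG N}

theorem IsCPDAGOf.exists_sib_of_transGen [Finite N] (h : G.IsCPDAGOf D) {x w y : N} (hw : w ≠ x)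
    (hxw : Relation.ReflTransGen G.Undir x w) (hwy : Relation.TransGen G.Dir w y) :
    ∃ v ∈ G.sib x, Relation.ReflTransGen (G.PossAvoiding x) v y := by
  obtain ⟨v, hv, hr⟩ := (exists_undir_avoiding hxw).resolve_left hw
  refine ⟨v, hv, ?_⟩
  have hne : ∀ z, Relation.TransGen G.Dir w z → z ≠ x := by
    rintro z hz rfl
    exact h.not_transGen hxw hz
  induction hwy with
  | single h' => exact hr.tail ⟨Or.inl h', hw, hne _ (.single h')⟩
  | tail h1 h2 ih => exact ih.tail ⟨Or.inl h2, hne _ h1, hne _ (h1.tail h2)⟩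

theorem IsCPDAGOf.exists_sib_of_active [Finite N] (h : G.IsCPDAGOf D) {x y v : N} (hxy : y ≠ x)
    (hv : v ∈ G.sib x) (hy : ¬ G.Dir y v) (hact : D.Active (G.pa v ∪ {x}) v y) :
    ∃ b ∈ G.sib x, Relation.ReflTransGen (G.PossAvoiding x) b y := by
  obtain ⟨m, hr⟩ := hact
  have hxv : Relation.ReflTransGen G.Undir x v := .single hv
  -- The ball is in the component of `x`, or strictly below a component node other than `x`, where
  -- nothing lies in the separator and it cannot turn, or stuck at a common parent entered from
  -- below. It may turn at `x` itself, so the sibling found can differ from `v`.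
  have key : ∀ t, D.Reach (G.pa v ∪ {x}) v t → Relation.ReflTransGen G.Undir x t.1 ∨
      (t.2 = true ∧ ∃ w, w ≠ x ∧ Relation.ReflTransGen G.Undir x w ∧
        Relation.TransGen G.Dir w t.1) ∨ (t.2 = false ∧ G.Dir t.1 v) := by
    intro t ht
    induction ht with
    | refl => exact Or.inl hxv
    | @tail s t _ hst ih =>
      obtain ⟨a, m⟩ := s
      obtain ⟨b, m'⟩ := t
      dsimp only at ih ⊢
      rcases DAG.step_cases hst with ⟨rfl, hab, ha⟩ | hup
      · simp only [Set.mem_union, Set.mem_singleton_iff, not_or] at ha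
        rcases ih with ih | ⟨-, w, hw, hxw, hwa⟩ | ⟨-, ih⟩
        · rcases h.dir_or_undir hab with hd | hu
          · exact Or.inr (Or.inl ⟨rfl, a, ha.2, ih, .single hd⟩)
          · exact Or.inl (ih.tail hu)
        · refine Or.inr (Or.inl ⟨rfl, w, hw, hxw, ?_⟩)
          rcases h.dir_or_undir hab with hd | hu
          · exact hwa.tail hd
          · exact h.transGen_trans_undir hwa hu
        · exact absurd ih ha.1
      · have hba : D.Edge b a := by tauto
        have hm' : m' = false := by tauto
        have hm : m = true → a ∈ G.pa v ∪ {x} := by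
          rintro rfl
          exact hup.elim (fun h => absurd h.2.2.1 (by simp)) fun h => h.2.2.2
        have hm2 : m = false → a ∉ G.pa v ∪ {x} := by
          rintro rfl
          exact hup.elim (fun h => h.2.2.2) fun h => absurd h.2.2.1 (by simp)
        rcases ih with ih | ⟨hmt, w, hw, hxw, hwa⟩ | ⟨hmf, ih⟩
        · rcases h.dir_or_undir hba with hd | hu
          · exact Or.inr (Or.inr ⟨hm', h.dir_trans_reflTransGen hd
              ((reflTransGen_undir_symm ih).trans hxv)⟩)
          · exact Or.inl (ih.tail (G.undir_symm _ _ hu))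
        · rcases hm hmt with ha | rfl
          · exact absurd (hwa.tail ha) (h.not_transGen ((reflTransGen_undir_symm hxv).trans hxw))
          · exact absurd hwa (h.not_transGen hxw)
        · exact absurd (Or.inl ih) (hm2 hmf)
  rcases key _ hr with h' | ⟨-, w, hw, hxw, hwy⟩ | ⟨-, h'⟩
  · exact (exists_undir_avoiding h').resolve_left hxy
  · exact h.exists_sib_of_transGen hw hxw hwy
  · exact absurd h' hy

/-- In a chain component of a CPDAG, the Bayes ball reaches along undirected edges. -/
theorem IsCPDAGOf.reach_undir [Finite N] (h : G.IsCPDAGOf D) {S T : Set N} {v w w' : N} {m : Bool}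
    (hT : ∀ t ∈ T, t ∉ S)
    (hr : Relation.ReflTransGen (fun s t => D.Step S s t ∧ G.Undir s.1 t.1 ∧ t.1 ∈ T)
      (v, false) (w, m)) (hv : v ∈ T) (hww' : G.Undir w w') (hw' : w' ∈ T) :
    ∃ m', Relation.ReflTransGen (fun s t => D.Step S s t ∧ G.Undir s.1 t.1 ∧ t.1 ∈ T)
      (v, false) (w', m') := by
  have key : ∀ t, Relation.ReflTransGen (fun s t => D.Step S s t ∧ G.Undir s.1 t.1 ∧ t.1 ∈ T)
      (v, false) t → t.1 ∈ T ∧ ∀ w' ∈ T, G.Undir t.1 w' →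
      ∃ m', Relation.ReflTransGen (fun s t => D.Step S s t ∧ G.Undir s.1 t.1 ∧ t.1 ∈ T)
        (v, false) (w', m') := by
    intro t ht
    induction ht with
    | refl =>
      refine ⟨hv, fun w' hw' hu => ?_⟩
      rcases h.adjacent hu with hd | hd
      · exact ⟨true, .single ⟨.down _ hd (hT _ hv), hu, hw'⟩⟩
      · exact ⟨false, .single ⟨.up hd (hT _ hv), hu, hw'⟩⟩
    | @tail s t hs hst ih =>
      obtain ⟨a, m⟩ := s
      obtain ⟨b, n⟩ := t
      obtain ⟨hst, hab, hb⟩ := hst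
      refine ⟨hb, fun w' hw' hu => ?_⟩
      have hr := hs.tail ⟨hst, hab, hb⟩
      dsimp only at *
      rcases h.adjacent hu with hd | hd
      · exact ⟨true, hr.tail ⟨.down _ hd (hT _ hb), hu, hw'⟩⟩
      · rcases DAG.step_cases hst with ⟨rfl, hd', -⟩ | hup
        · by_cases haw : a = w'
          · subst haw
            exact ⟨m, hs⟩
          -- The collider `a → b ← w'` is shielded by an undirected edge, so `w'` is reached from
          -- `a` instead.
          · exact ih.2 w' hw' (h.undir_of_colliding hd' hd haw (G.undir_symm _ _ hab) hu)
        · obtain rfl : n = false := by tauto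
          exact ⟨false, hr.tail ⟨.up hd (hT _ hb), hu, hw'⟩⟩
  exact (key _ hr).2 w' hw' hww'

theorem IsCPDAGOf.active_of_reflTransGen [Finite N] (h : G.IsCPDAGOf D) {x y v : N}
    (hv : v ∈ G.sib x) (hvy : Relation.ReflTransGen (G.PossAvoiding x) v y) :
    D.Active (G.pa v ∪ {x}) v y := by
  set S := G.pa v ∪ {x}
  -- The component without `x`: it misses `S`, since a parent of `v` inside it would close a
  -- partially directed cycle.
  set T := {t | Relation.ReflTransGen G.Undir v t ∧ t ≠ x}
  have hT : ∀ t ∈ T, t ∉ S := by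
    rintro t ⟨ht, htx⟩ (hts | hts)
    · exact h.not_transGen ht (.single hts)
    · exact htx hts
  have hvT : v ∈ T := ⟨.refl, by rintro rfl; exact G.undir_irrefl _ hv⟩
  have hQ : ∀ t ∈ T, ∀ q, Relation.TransGen G.Dir t q → q ∉ S := by
    rintro t ⟨ht, htx⟩ q hq (hqs | rfl)
    · exact h.not_transGen ht (hq.tail hqs)
    · exact h.not_transGen (.head hv ht) hq
  -- Either the walk is still in `T`, or it left `T` by a directed edge, and later undirected edges
  -- are absorbed into the descent.
  have key : (y ∈ T ∧ ∃ m, Relation.ReflTransGen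
        (fun s t => D.Step S s t ∧ G.Undir s.1 t.1 ∧ t.1 ∈ T) (v, false) (y, m)) ∨
      ∃ t ∈ T, D.Active S v t ∧ Relation.TransGen G.Dir t y := by
    induction hvy with
    | refl => exact Or.inl ⟨hvT, false, .refl⟩
    | @tail a b _ hab ih =>
      obtain ⟨hab, hax, hbx⟩ := hab
      rcases ih with ⟨haT, m, hr⟩ | ⟨t, ht, hact, hta⟩
      · rcases hab with hd | hu
        · exact Or.inr ⟨a, haT, ⟨m, Relation.ReflTransGen.mono (fun _ _ h => h.1) _ _ hr⟩, .single hd⟩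
        · have hbT : b ∈ T := ⟨haT.1.tail hu, hbx⟩
          exact Or.inl ⟨hbT, h.reach_undir hT hr hvT hu hbT⟩
      · refine Or.inr ⟨t, ht, hact, ?_⟩
        rcases hab with hd | hu
        · exact hta.tail hd
        · exact h.transGen_trans_undir hta hu
  rcases key with ⟨-, m, hr⟩ | ⟨t, ht, ⟨m, hr⟩, hty⟩
  · exact ⟨m, Relation.ReflTransGen.mono (fun _ _ h => h.1) _ _ hr⟩
  · refine ⟨true, ?_⟩
    clear hvy
    induction hty with
    | single hd => exact hr.tail (.down _ (h.edge hd) (hT t ht))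
    | tail h1 h2 ih => exact ih.tail (.down _ (h.edge h2) (hQ t ht _ h1))

theorem IsCPDAGOf.amenable_iff_dSep [Finite N] (h : G.IsCPDAGOf D) {x y : N} (hxy : x ≠ y)
    (hx : x ∈ G.possAn y) :
    G.Amenable x y ↔ ∀ v ∈ G.sib x, D.DSep {v} {y} (G.pa v ∪ {x}) := by
  rw [amenable_iff hxy]
  constructor
  · intro ha v hv
    rw [DAG.dSep_singleton_iff]
    -- `y → v - x` would give `y → x` in every represented DAG, including one where `x` is an
    -- ancestor of `y`.
    have hyv : ¬ G.Dir y v := fun hd => by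
      obtain ⟨D₀, hD₀, hanc⟩ := hx
      exact (hD₀.edge (h.dir_trans_undir hd (G.undir_symm _ _ hv))).not_isAncestor hanc
    refine ⟨?_, ?_, ?_, fun hact => ?_⟩
    · rintro rfl
      exact ha v hv .refl
    · rintro (hd | rfl)
      · exact G.dir_asymm _ _ hd hd
      · exact G.undir_irrefl _ hv
    · rintro (hd | rfl)
      · exact hyv hd
      · exact hxy rfl
    · obtain ⟨b, hb, hr⟩ := h.exists_sib_of_active hxy.symm hv hyv hact
      exact ha b hb hr
  · intro hs v hv hr
    exact (DAG.dSep_singleton_iff.1 (hs v hv)).2.2.2 (h.active_of_reflTransGen hv hr)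

end MixedGraph

theorem mainTheorem3 {N : Type u} [Finite N] (G : MixedGraph N) (hG : G.IsCPDAG)
    (X Y : N) (hXY : X ≠ Y) (hX : X ∈ G.possAn Y) :
    -- conditional independence as d-separation in any DAG represented by `G`
    (∀ D : DAG N, G.IsCPDAGOf D →
      (G.Amenable X Y ↔ ∀ V ∈ G.sib X, D.DSep {V} {Y} (G.pa V ∪ {X}))) ∧
    -- conditional independence in any distribution that is Markov and faithful to such a DAG
    (∀ D : DAG N, G.IsCPDAGOf D →
      ∀ (E : N → Type w) [∀ v, MeasurableSpace (E v)] [∀ v, StandardBorelSpace (E v)]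
        (p : Measure (∀ v, E v)) [IsProbabilityMeasure p],
        IsMarkovTo p D → IsFaithfulTo p D →
        (G.Amenable X Y ↔ ∀ V ∈ G.sib X, CondIndepVars p {V} {Y} (G.pa V ∪ {X}))) := by
  refine ⟨fun D hD => hD.amenable_iff_dSep hXY hX, fun D hD E _ _ p _ hM hF => ?_⟩
  rw [hD.amenable_iff_dSep hXY hX]
  exact forall₂_congr fun V _ => ⟨hM _ _ _, hF _ _ _⟩
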